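/- There is an absolute constant $C>0$ with the following property. Let $\Gamma$ be any probability distribution on $[0,1]\times\{0,1\}$, let $\varepsilon>0$, and let $n\ge C\varepsilon^{-2}$ be an integer. If $S=((v_1,y_1),\dots,(v_n,y_n))$ consists of $n$ i.i.d. draws from $\Gamma$, and $\hat\Gamma_S=\frac1n\sum_{i=1}^n\delta_{(v_i,y_i)}$ is the empirical distribution of the sample, then with probability at least $2/3$ $$\bigl|\underline{\mathsf{dCE}}(\hat\Gamma_S)-\underline{\mathsf{dCE}}(\Gamma)\bigr|\le\varepsilon .$$ Here the lower distance to calibration of a probability distribution $\Gamma$ on $[0,1]\times\{0,1\}$ is $$\underline{\mathsf{dCE}}(\Gamma)=\inf_{\Pi\in\mathsf{ext}(\Gamma)}\ \mathbb E_{(u,v,y)\sim\Pi}|u-v|,$$ where $\mathsf{ext}(\Gamma)$ is the set of all probability distributions $\Pi$ of triples $(u,v,y)\in[0,1]\times[0,1]\times\{0,1\}$ such that the marginal distribution of $(v,y)$ is $\Gamma$ and the marginal distribution of $(u,y)$ is perfectly calibrated, i.e. $\mathbb E_\Pi[y\mid u]=u$ almost surely. -/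

import Mathlib

open MeasureTheory

noncomputable section

/-- A prediction-label pair `(v, y)`: a prediction `v ∈ [0,1]` and a label `y ∈ {0,1}`
(`false` is the label `0`, `true` is the label `1`). -/
abbrev PredLabel : Type := unitInterval × Bool

/-- The label `y ∈ {0,1}` as a real number. -/
def labelValue (y : Bool) : ℝ := if y then 1 else 0

/-- A distribution `Γ` of pairs `(v, y)` is perfectly calibrated when `E[y | v] = v` almost surely,
the conditional expectation being taken given the `σ`-algebra generated by the prediction `v`. -/
def PerfectlyCalibrated (Γ : Measure PredLabel) : Prop :=
  Γ[fun p : PredLabel => labelValue p.2 |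
      MeasurableSpace.comap (Prod.fst : PredLabel → unitInterval) inferInstance]
    =ᵐ[Γ] fun p : PredLabel => (p.1 : ℝ)

/-- `ext Γ`: the joint distributions `P` of triples `(u, v, y)` such that `(v, y)` has law `Γ` and
the law of `(u, y)` is perfectly calibrated. -/
def extCouplings (Γ : Measure PredLabel) : Set (Measure (unitInterval × unitInterval × Bool)) :=
  {P | IsProbabilityMeasure P ∧
    P.map (fun t => (t.2.1, t.2.2)) = Γ ∧
    PerfectlyCalibrated (P.map (fun t => (t.1, t.2.2)))}

/-- The lower distance to calibration: the infimum of `E |u - v|` over `ext Γ`. -/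
def lowerDCE (Γ : Measure PredLabel) : ℝ :=
  sInf ((fun P : Measure (unitInterval × unitInterval × Bool) =>
    ∫ t, |(t.1 : ℝ) - (t.2.1 : ℝ)| ∂P) '' extCouplings Γ)

/-- The empirical distribution of a sample `S`: mass `1 / n` on each of the `n` sample points. -/
def empiricalMeasure {n : ℕ} (S : Fin n → PredLabel) : Measure PredLabel :=
  (n : ENNReal)⁻¹ • ∑ i, Measure.dirac (S i)

end

/-!
The lower distance to calibration is `1`-Lipschitz for the transport distance on labelled
predictions with cost `|v - v'| + |y - y'|` (`abs_lowerDCE_sub_le`). To see this, glue a member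
`(u, v, y)` of `ext Γ` to a coupling of `(v, y)` with `(v', y')`. The pair `(u, y')` need not be
calibrated, but `(u', y')` is, where `u' = E[y' | u]`. Since `u = E[y | u]`, contractivity of
conditional expectation in `L¹` gives `E|u' - u| ≤ E|y' - y|`
(`lowerDCE_le_of_perfectlyCalibrated`). No duality is needed.

The map `(v, y) ↦ v + 2 y` places labelled predictions on the real line and distorts the cost by a
factor of at most `2`. On the line, the quantile coupling bounds the transport distance by the `L¹`
distance of the distribution functions (`lintegral_abs_lowerQuantile_sub_le`), so the lower distance
to calibration is controlled by that `L¹` distance (`ofReal_abs_lowerDCE_sub_le`).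

At each point of `[0, 3]` the empirical distribution function deviates from the true one by at most
`1 / √n` in mean, by the variance of a sum of independent indicators. Integrating over the interval
(`lintegral_lintegral_abs_empiricalMeasure_sub_le`) and applying Markov's inequality concludes.
-/

open ProbabilityTheory Set

/-! ### Perfect calibration -/

theorem measurable_labelValue : Measurable labelValue := measurable_of_finite _

theorem labelValue_mem_Icc (y : Bool) : labelValue y ∈ Icc (0 : ℝ) 1 := by
  cases y <;> simp [labelValue]

theorem integrable_of_mem_Icc {Ω : Type*} [MeasurableSpace Ω] {P : Measure Ω} [IsFiniteMeasure P]
    {f : Ω → ℝ} {a b : ℝ} (hf : Measurable f) (h : ∀ ω, f ω ∈ Icc a b) : Integrable f P :=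
  Integrable.of_mem_Icc a b hf.aemeasurable (ae_of_all _ h)

theorem perfectlyCalibrated_iff_setIntegral_eq (Γ : Measure PredLabel) [IsProbabilityMeasure Γ] :
    PerfectlyCalibrated Γ ↔ ∀ B : Set unitInterval, MeasurableSet B →
      ∫ p in Prod.fst ⁻¹' B, labelValue p.2 ∂Γ = ∫ p in Prod.fst ⁻¹' B, (p.1 : ℝ) ∂Γ := by
  have hm : MeasurableSpace.comap (Prod.fst : PredLabel → unitInterval) inferInstance
      ≤ (inferInstance : MeasurableSpace PredLabel) := measurable_fst.comap_le
  have hl : Integrable (fun p : PredLabel => labelValue p.2) Γ :=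
    integrable_of_mem_Icc (measurable_labelValue.comp measurable_snd)
      fun p => labelValue_mem_Icc p.2
  have hv : Integrable (fun p : PredLabel => (p.1 : ℝ)) Γ :=
    integrable_of_mem_Icc (by fun_prop) fun p => p.1.2
  constructor
  · intro h B hB
    have hB' : MeasurableSet[MeasurableSpace.comap (Prod.fst : PredLabel → unitInterval)
        inferInstance] (Prod.fst ⁻¹' B) := ⟨B, hB, rfl⟩
    rw [← setIntegral_condExp hm hl hB']
    exact integral_congr_ae (ae_restrict_of_ae h)
  · intro h
    refine (ae_eq_condExp_of_forall_setIntegral_eq hm hl (fun _ _ _ => hv.integrableOn) ?_ ?_).symm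
    · rintro _ ⟨B, hB, rfl⟩ -
      exact (h B hB).symm
    · exact (measurable_subtype_coe.comp
        (comap_measurable (Prod.fst : PredLabel → unitInterval))).aestronglyMeasurable

section

variable {Ω : Type*} [mΩ : MeasurableSpace Ω] {P : Measure Ω} [IsProbabilityMeasure P]

theorem perfectlyCalibrated_map_iff {U : Ω → unitInterval} {Y : Ω → Bool} (hU : Measurable U)
    (hY : Measurable Y) :
    PerfectlyCalibrated (P.map fun ω => (U ω, Y ω)) ↔
      ∀ B : Set unitInterval, MeasurableSet B →
        ∫ ω in U ⁻¹' B, labelValue (Y ω) ∂P = ∫ ω in U ⁻¹' B, (U ω : ℝ) ∂P := by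
  have hUY : Measurable fun ω => (U ω, Y ω) := hU.prodMk hY
  have : IsProbabilityMeasure (P.map fun ω => (U ω, Y ω)) :=
    Measure.isProbabilityMeasure_map hUY.aemeasurable
  have hl : Measurable fun p : PredLabel => labelValue p.2 :=
    measurable_labelValue.comp measurable_snd
  rw [perfectlyCalibrated_iff_setIntegral_eq]
  refine forall₂_congr fun B hB => ?_
  rw [setIntegral_map (measurable_fst hB)
      hl.aestronglyMeasurable hUY.aemeasurable,
    setIntegral_map (measurable_fst hB) (by fun_prop) hUY.aemeasurable]
  rfl

theorem condExp_ae_eq_of_perfectlyCalibrated {U : Ω → unitInterval} {Y : Ω → Bool}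
    (hU : Measurable U) (hY : Measurable Y)
    (h : PerfectlyCalibrated (P.map fun ω => (U ω, Y ω))) :
    P[fun ω => labelValue (Y ω) | MeasurableSpace.comap U inferInstance]
      =ᵐ[P] fun ω => (U ω : ℝ) := by
  rw [perfectlyCalibrated_map_iff hU hY] at h
  refine (ae_eq_condExp_of_forall_setIntegral_eq hU.comap_le
    (integrable_of_mem_Icc (measurable_labelValue.comp hY) fun ω => labelValue_mem_Icc _)
    (fun _ _ _ => (integrable_of_mem_Icc (measurable_subtype_coe.comp hU)
      fun ω => (U ω).2).integrableOn) ?_ ?_).symm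
  · rintro _ ⟨B, hB, rfl⟩ -
    exact (h B hB).symm
  · exact (measurable_subtype_coe.comp (comap_measurable U)).aestronglyMeasurable

/-- Recalibration: conditioning the label on any `σ`-algebra `m` produces a perfectly calibrated
prediction, by the tower property. -/
theorem exists_perfectlyCalibrated_condExp {Ω : Type*} {m mΩ : MeasurableSpace Ω} {P : Measure Ω}
    [IsProbabilityMeasure P] (hm : m ≤ mΩ) {Y : Ω → Bool} (hY : Measurable Y) :
    ∃ U : Ω → unitInterval, Measurable U ∧
      (fun ω => (U ω : ℝ)) =ᵐ[P] P[fun ω => labelValue (Y ω) | m] ∧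
      PerfectlyCalibrated (P.map fun ω => (U ω, Y ω)) := by
  have hl : Integrable (fun ω => labelValue (Y ω)) P :=
    integrable_of_mem_Icc (measurable_labelValue.comp hY) fun ω => labelValue_mem_Icc _
  set g : Ω → ℝ := P[fun ω => labelValue (Y ω) | m] with hg
  have hgm : Measurable[m] g := stronglyMeasurable_condExp.measurable
  have h0 : 0 ≤ᵐ[P] g := condExp_nonneg (ae_of_all _ fun ω => (labelValue_mem_Icc _).1)
  have h1 : g ≤ᵐ[P] fun _ => 1 := by
    have := condExp_mono (m := m) hl (integrable_const (1 : ℝ))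
      (ae_of_all P fun ω => (labelValue_mem_Icc (Y ω)).2)
    rwa [condExp_const hm] at this
  have hUm : Measurable[m] fun ω => projIcc (0 : ℝ) 1 zero_le_one (g ω) :=
    continuous_projIcc.measurable.comp hgm
  have hUg : (fun ω => (projIcc (0 : ℝ) 1 zero_le_one (g ω) : ℝ)) =ᵐ[P] g := by
    filter_upwards [h0, h1] with ω h0 h1
    rw [projIcc_of_mem zero_le_one ⟨h0, h1⟩]
  refine ⟨fun ω => projIcc (0 : ℝ) 1 zero_le_one (g ω), hUm.mono hm le_rfl, hUg, ?_⟩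
  rw [perfectlyCalibrated_map_iff (hUm.mono hm le_rfl) hY]
  intro B hB
  rw [← setIntegral_condExp hm hl (hUm hB)]
  exact integral_congr_ae (ae_restrict_of_ae hUg.symm)

/-! ### The lower distance to calibration is Lipschitz for the transport distance -/

theorem map_mem_extCouplings {U V : Ω → unitInterval} {Y : Ω → Bool} (hU : Measurable U)
    (hV : Measurable V) (hY : Measurable Y)
    (h : PerfectlyCalibrated (P.map fun ω => (U ω, Y ω))) :
    P.map (fun ω => (U ω, V ω, Y ω)) ∈ extCouplings (P.map fun ω => (V ω, Y ω)) := by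
  have hUVY : Measurable fun ω => (U ω, V ω, Y ω) := hU.prodMk (hV.prodMk hY)
  refine ⟨Measure.isProbabilityMeasure_map hUVY.aemeasurable, ?_, ?_⟩
  · rw [Measure.map_map (by fun_prop) hUVY]; rfl
  · rw [Measure.map_map (by fun_prop) hUVY]; exact h

theorem extCouplings_nonempty (Γ : Measure PredLabel) [IsProbabilityMeasure Γ] :
    (extCouplings Γ).Nonempty := by
  obtain ⟨U, hU, -, h⟩ := exists_perfectlyCalibrated_condExp (P := Γ) bot_le measurable_snd
  have := map_mem_extCouplings hU measurable_fst measurable_snd h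
  exact ⟨_, by simpa using this⟩

theorem lowerDCE_le_integral {U V : Ω → unitInterval} {Y : Ω → Bool} (hU : Measurable U)
    (hV : Measurable V) (hY : Measurable Y)
    (h : PerfectlyCalibrated (P.map fun ω => (U ω, Y ω))) :
    lowerDCE (P.map fun ω => (V ω, Y ω)) ≤ ∫ ω, |(U ω : ℝ) - V ω| ∂P := by
  refine csInf_le ⟨0, ?_⟩ ⟨_, map_mem_extCouplings hU hV hY h, ?_⟩
  · rintro _ ⟨Q, -, rfl⟩
    exact integral_nonneg fun _ => abs_nonneg _
  · exact integral_map (hU.prodMk (hV.prodMk hY)).aemeasurable (by fun_prop)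

end

/-- The transport cost between labelled predictions: predictions are compared in absolute value,
and a change of label costs `1`. -/
def transportCost (p q : PredLabel) : ℝ :=
  |(p.1 : ℝ) - q.1| + |labelValue p.2 - labelValue q.2|

theorem measurable_transportCost :
    Measurable fun r : PredLabel × PredLabel => transportCost r.1 r.2 := by
  have := measurable_labelValue
  unfold transportCost
  fun_prop

theorem transportCost_comm (p q : PredLabel) : transportCost p q = transportCost q p := by
  simp only [transportCost, abs_sub_comm]

theorem transportCost_mem_Icc (p q : PredLabel) : transportCost p q ∈ Icc (0 : ℝ) 2 := by
  have hp := p.1.2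
  have hq := q.1.2
  have hp' := labelValue_mem_Icc p.2
  have hq' := labelValue_mem_Icc q.2
  have h1 : |(p.1 : ℝ) - q.1| ≤ 1 := abs_le.2 ⟨by linarith [hp.1, hq.2], by linarith [hp.2, hq.1]⟩
  have h2 : |labelValue p.2 - labelValue q.2| ≤ 1 :=
    abs_le.2 ⟨by linarith [hp'.1, hq'.2], by linarith [hp'.2, hq'.1]⟩
  exact ⟨by unfold transportCost; positivity, by unfold transportCost; linarith⟩

section

variable {Ω : Type*} [mΩ : MeasurableSpace Ω] {P : Measure Ω} [IsProbabilityMeasure P]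

/-- A calibrated prediction `U` for `(V, Y)` is turned into the calibrated prediction `E[Y' | U]`
for `(V', Y')`. Since `U = E[Y | U]`, the `L¹`-contraction property bounds the mean displacement of
`U` by `E|Y - Y'|`. -/
theorem lowerDCE_le_of_perfectlyCalibrated {U V V' : Ω → unitInterval} {Y Y' : Ω → Bool}
    (hU : Measurable U) (hV : Measurable V) (hY : Measurable Y) (hV' : Measurable V')
    (hY' : Measurable Y') (h : PerfectlyCalibrated (P.map fun ω => (U ω, Y ω))) :
    lowerDCE (P.map fun ω => (V' ω, Y' ω)) ≤
      ∫ ω, |(U ω : ℝ) - V ω| ∂P + ∫ ω, transportCost (V ω, Y ω) (V' ω, Y' ω) ∂P := by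
  obtain ⟨U', hU', hU'eq, hcal⟩ := exists_perfectlyCalibrated_condExp (P := P) hU.comap_le hY'
  have hUeq := condExp_ae_eq_of_perfectlyCalibrated hU hY h
  have hlab : ∀ {Z : Ω → Bool}, Measurable Z → Integrable (fun ω => labelValue (Z ω)) P :=
    fun hZ => integrable_of_mem_Icc (measurable_labelValue.comp hZ) fun ω => labelValue_mem_Icc _
  have hpred : ∀ {Z : Ω → unitInterval}, Measurable Z → Integrable (fun ω => (Z ω : ℝ)) P :=
    fun hZ => integrable_of_mem_Icc (measurable_subtype_coe.comp hZ) fun ω => Subtype.prop _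
  have key : ∫ ω, |(U' ω : ℝ) - U ω| ∂P ≤ ∫ ω, |labelValue (Y ω) - labelValue (Y' ω)| ∂P := by
    have hsub := condExp_sub (hlab hY') (hlab hY) (MeasurableSpace.comap U inferInstance)
    calc ∫ ω, |(U' ω : ℝ) - U ω| ∂P
        = ∫ ω, |(P[(fun ω => labelValue (Y' ω)) - (fun ω => labelValue (Y ω)) |
            MeasurableSpace.comap U inferInstance]) ω| ∂P := by
          refine integral_congr_ae ?_
          filter_upwards [hU'eq, hUeq, hsub] with ω h1 h2 h3
          rw [h3, Pi.sub_apply, h1, h2]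
      _ ≤ ∫ ω, |((fun ω => labelValue (Y' ω)) - (fun ω => labelValue (Y ω))) ω| ∂P :=
          integral_abs_condExp_le _
      _ = ∫ ω, |labelValue (Y ω) - labelValue (Y' ω)| ∂P := by
          simp only [Pi.sub_apply, abs_sub_comm]
  have i1 : Integrable (fun ω => |(U ω : ℝ) - V ω|) P := ((hpred hU).sub (hpred hV)).abs
  have i2 : Integrable (fun ω => |(U' ω : ℝ) - U ω|) P := ((hpred hU').sub (hpred hU)).abs
  have i3 : Integrable (fun ω => |(V ω : ℝ) - V' ω|) P := ((hpred hV).sub (hpred hV')).abs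
  have i4 : Integrable (fun ω => |labelValue (Y ω) - labelValue (Y' ω)|) P :=
    ((hlab hY).sub (hlab hY')).abs
  calc lowerDCE (P.map fun ω => (V' ω, Y' ω)) ≤ ∫ ω, |(U' ω : ℝ) - V' ω| ∂P :=
        lowerDCE_le_integral hU' hV' hY' hcal
    _ ≤ ∫ ω, (|(U' ω : ℝ) - U ω| + |(U ω : ℝ) - V ω| + |(V ω : ℝ) - V' ω|) ∂P := by
        refine integral_mono ((hpred hU').sub (hpred hV')).abs ((i2.add i1).add i3) fun ω => ?_
        have h1 := abs_sub_le (U' ω : ℝ) (U ω) (V' ω)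
        have h2 := abs_sub_le (U ω : ℝ) (V ω) (V' ω)
        dsimp only
        linarith
    _ = ∫ ω, |(U' ω : ℝ) - U ω| ∂P + ∫ ω, |(U ω : ℝ) - V ω| ∂P + ∫ ω, |(V ω : ℝ) - V' ω| ∂P := by
        rw [← integral_add i2 i1]
        exact integral_add (i2.add i1) i3
    _ ≤ ∫ ω, |(U ω : ℝ) - V ω| ∂P + ∫ ω, transportCost (V ω, Y ω) (V' ω, Y' ω) ∂P := by
        simp only [transportCost]
        rw [integral_add i3 i4]
        linarith

end

/-- A member of `ext Γ` and a coupling `κ` of `Γ` with `Γ'` are glued along `(v, y)`: the second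
pair is drawn from the conditional law of `κ` given the first one. -/
theorem lowerDCE_snd_le (κ : Measure (PredLabel × PredLabel)) [IsProbabilityMeasure κ] :
    lowerDCE κ.snd ≤ lowerDCE κ.fst + ∫ r, transportCost r.1 r.2 ∂κ := by
  rw [← sub_le_iff_le_add]
  refine le_csInf ((extCouplings_nonempty κ.fst).image _) ?_
  rintro _ ⟨Q, ⟨hQ, hmarg, hcal⟩, rfl⟩
  rw [sub_le_iff_le_add]
  have hs : Measurable (Prod.snd : unitInterval × PredLabel → PredLabel) := measurable_snd
  let ρ := Q ⊗ₘ (κ.condKernel.comap (Prod.snd : unitInterval × PredLabel → PredLabel) hs)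
  have hglue : ρ.map (fun x => (x.1.2, x.2)) = κ := by
    conv_rhs => rw [← κ.disintegrate κ.condKernel]
    ext A hA
    have hmeas : Measurable fun x : (unitInterval × PredLabel) × PredLabel => (x.1.2, x.2) := by
      fun_prop
    rw [Measure.map_apply hmeas hA, Measure.compProd_apply (hmeas hA),
      Measure.compProd_apply hA, ← hmarg, lintegral_map (Kernel.measurable_kernel_prodMk_left hA) hs]
    rfl
  have hfst : ρ.map Prod.fst = Q := Measure.fst_compProd _ _
  have hU : Measurable fun x : (unitInterval × PredLabel) × PredLabel => x.1.1 := by fun_prop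
  have hV : Measurable fun x : (unitInterval × PredLabel) × PredLabel => x.1.2.1 := by fun_prop
  have hY : Measurable fun x : (unitInterval × PredLabel) × PredLabel => x.1.2.2 := by fun_prop
  have hV' : Measurable fun x : (unitInterval × PredLabel) × PredLabel => x.2.1 := by fun_prop
  have hY' : Measurable fun x : (unitInterval × PredLabel) × PredLabel => x.2.2 := by fun_prop
  have hcal' : PerfectlyCalibrated (ρ.map fun x => (x.1.1, x.1.2.2)) := by
    rw [← hfst, Measure.map_map (by fun_prop) measurable_fst] at hcal
    exact hcal
  have := lowerDCE_le_of_perfectlyCalibrated hU hV hY hV' hY' hcal'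
  have e1 : ρ.map (fun x => (x.2.1, x.2.2)) = κ.snd := by
    conv_rhs => rw [← hglue]
    rw [Measure.snd, Measure.map_map measurable_snd (by fun_prop)]
    rfl
  have e2 : ∫ x, |(x.1.1 : ℝ) - x.1.2.1| ∂ρ = ∫ t, |(t.1 : ℝ) - t.2.1| ∂Q := by
    rw [← hfst, integral_map measurable_fst.aemeasurable (by fun_prop)]
  have e3 : ∫ x, transportCost (x.1.2.1, x.1.2.2) (x.2.1, x.2.2) ∂ρ
      = ∫ r, transportCost r.1 r.2 ∂κ := by
    conv_rhs => rw [← hglue]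
    rw [integral_map (by fun_prop) measurable_transportCost.aestronglyMeasurable]
  rw [e1, e2, e3] at this
  exact this

theorem abs_lowerDCE_sub_le (κ : Measure (PredLabel × PredLabel)) [IsProbabilityMeasure κ] :
    |lowerDCE κ.fst - lowerDCE κ.snd| ≤ ∫ r, transportCost r.1 r.2 ∂κ := by
  have h1 := lowerDCE_snd_le κ
  have : IsProbabilityMeasure (κ.map Prod.swap) :=
    Measure.isProbabilityMeasure_map measurable_swap.aemeasurable
  have h2 := lowerDCE_snd_le (κ.map Prod.swap)
  rw [integral_map measurable_swap.aemeasurable measurable_transportCost.aestronglyMeasurable,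
    Measure.fst_map_swap, Measure.snd_map_swap] at h2
  simp only [Prod.fst_swap, Prod.snd_swap, transportCost_comm (Prod.snd _)] at h2
  exact abs_sub_le_iff.2 ⟨by linarith, by linarith⟩

/-! ### Quantile coupling on the real line -/

/-- The lower quantile function of a probability measure on `ℝ`; it is meaningful for levels in
the open interval `(0, 1)`. -/
noncomputable def lowerQuantile (μ : Measure ℝ) (ω : ℝ) : ℝ := sInf {x | ω ≤ cdf μ x}

theorem lowerQuantile_le_iff (μ : Measure ℝ) {ω : ℝ} (hω : ω ∈ Ioo (0 : ℝ) 1) (x : ℝ) :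
    lowerQuantile μ ω ≤ x ↔ ω ≤ cdf μ x := by
  have hne : {x | ω ≤ cdf μ x}.Nonempty :=
    ((tendsto_cdf_atTop μ).eventually_const_le hω.2).exists
  obtain ⟨b, hb⟩ := ((tendsto_cdf_atBot μ).eventually_lt_const hω.1).exists
  have hbdd : BddBelow {x | ω ≤ cdf μ x} :=
    ⟨b, fun y hy => le_of_not_gt fun h => absurd (monotone_cdf μ h.le) (not_le.2 (hb.trans_le hy))⟩
  constructor
  · intro h
    refine le_trans ?_ (monotone_cdf μ h)
    -- The infimum is attained because the distribution function is right-continuous.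
    have hlim : Filter.Tendsto (cdf μ) (nhdsWithin (lowerQuantile μ ω) (Ioi (lowerQuantile μ ω)))
        (nhds (cdf μ (lowerQuantile μ ω))) :=
      (((cdf μ).right_continuous (lowerQuantile μ ω)).mono Ioi_subset_Ici_self)
    refine ge_of_tendsto hlim ?_
    filter_upwards [self_mem_nhdsWithin] with y hy
    obtain ⟨z, hz, hzy⟩ := exists_lt_of_csInf_lt hne hy
    exact le_trans hz (monotone_cdf μ hzy.le)
  · exact fun h => csInf_le hbdd h

/-- Lebesgue measure on `(0, 1)`. -/
noncomputable abbrev uniformMeasure : Measure ℝ := volume.restrict (Ioo (0 : ℝ) 1)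

instance : IsProbabilityMeasure uniformMeasure := ⟨by simp⟩

theorem aemeasurable_lowerQuantile (μ : Measure ℝ) :
    AEMeasurable (lowerQuantile μ) uniformMeasure := by
  refine aemeasurable_restrict_of_monotoneOn measurableSet_Ioo fun a ha b hb hab => ?_
  rw [lowerQuantile_le_iff μ ha]
  exact hab.trans ((lowerQuantile_le_iff μ hb _).1 le_rfl)

theorem map_lowerQuantile (μ : Measure ℝ) [IsProbabilityMeasure μ] :
    uniformMeasure.map (lowerQuantile μ) = μ := by
  have : IsProbabilityMeasure (uniformMeasure.map (lowerQuantile μ)) :=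
    Measure.isProbabilityMeasure_map (aemeasurable_lowerQuantile μ)
  refine Measure.ext_of_Iic _ _ fun x => ?_
  rw [Measure.map_apply_of_aemeasurable (aemeasurable_lowerQuantile μ) measurableSet_Iic,
    Measure.restrict_apply' measurableSet_Ioo, ← ofReal_cdf]
  have h1 := cdf_le_one μ x
  apply le_antisymm
  · calc volume (lowerQuantile μ ⁻¹' Iic x ∩ Ioo 0 1) ≤ volume (Ioc 0 (cdf μ x)) :=
          measure_mono fun ω hω => ⟨hω.2.1, (lowerQuantile_le_iff μ hω.2 x).1 hω.1⟩
      _ = ENNReal.ofReal (cdf μ x) := by simp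
  · calc ENNReal.ofReal (cdf μ x) = volume (Ioo 0 (cdf μ x)) := by simp
      _ ≤ volume (lowerQuantile μ ⁻¹' Iic x ∩ Ioo 0 1) := by
          refine measure_mono fun ω hω => ?_
          have hω' : ω ∈ Ioo (0 : ℝ) 1 := ⟨hω.1, hω.2.trans_le h1⟩
          exact ⟨(lowerQuantile_le_iff μ hω' x).2 hω.2.le, hω'⟩

/-- Both sides measure the region between the two distribution functions, sliced along the levels
on the left and along the real line on the right. -/
theorem lintegral_abs_lowerQuantile_sub_le (μ ν : Measure ℝ) :
    ∫⁻ ω, ENNReal.ofReal |lowerQuantile μ ω - lowerQuantile ν ω| ∂uniformMeasure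
      ≤ ∫⁻ t, ENNReal.ofReal |cdf μ t - cdf ν t| := by
  have hμ : Measurable (cdf μ) := (monotone_cdf μ).measurable
  have hν : Measurable (cdf ν) := (monotone_cdf ν).measurable
  let A : Set (ℝ × ℝ) := {p | p.1 ∈ uIoc (cdf ν p.2) (cdf μ p.2)}
  have hA : MeasurableSet A := by
    have h1 : Measurable fun p : ℝ × ℝ => min (cdf ν p.2) (cdf μ p.2) := by fun_prop
    have h2 : Measurable fun p : ℝ × ℝ => max (cdf ν p.2) (cdf μ p.2) := by fun_prop
    exact (measurableSet_lt h1 measurable_fst).inter (measurableSet_le measurable_fst h2)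
  calc ∫⁻ ω, ENNReal.ofReal |lowerQuantile μ ω - lowerQuantile ν ω| ∂uniformMeasure
      = ∫⁻ ω in Ioo 0 1, volume (Prod.mk ω ⁻¹' A) := by
        refine setLIntegral_congr_fun measurableSet_Ioo fun ω hω => ?_
        have hlt : ∀ (ρ : Measure ℝ) (t : ℝ), t < lowerQuantile ρ ω ↔ cdf ρ t < ω := fun ρ t => by
          rw [← not_le, lowerQuantile_le_iff ρ hω, not_le]
        have : Prod.mk ω ⁻¹' A = Ico (min (lowerQuantile ν ω) (lowerQuantile μ ω))
            (max (lowerQuantile ν ω) (lowerQuantile μ ω)) := by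
          ext t
          simp only [A, mem_preimage, mem_ofPred_eq, mem_uIoc, mem_Ico, min_le_iff, lt_max_iff,
            hlt, lowerQuantile_le_iff _ hω]
          grind
        rw [this, Real.volume_Ico, max_sub_min_eq_abs]
    _ ≤ ∫⁻ ω, volume (Prod.mk ω ⁻¹' A) := setLIntegral_le_lintegral _ _
    _ = ∫⁻ t, volume ((fun ω => (ω, t)) ⁻¹' A) := by
        rw [← Measure.prod_apply hA, Measure.prod_apply_symm hA]
    _ = ∫⁻ t, ENNReal.ofReal |cdf μ t - cdf ν t| := by
        refine lintegral_congr fun t => ?_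
        exact Real.volume_uIoc (a := cdf ν t) (b := cdf μ t)

/-! ### Labelled predictions on the real line -/

/-- The position `v + 2 y` of a labelled prediction `(v, y)` on the real line. The two labels occupy
the intervals `[0, 1]` and `[2, 3]`, which lie at distance `1`. -/
def toLine (p : PredLabel) : ℝ := p.1 + 2 * labelValue p.2

/-- A measurable left inverse of `toLine`. -/
noncomputable def ofLine (x : ℝ) : PredLabel :=
  if x ≤ 1 then (projIcc 0 1 zero_le_one x, false) else (projIcc 0 1 zero_le_one (x - 2), true)

theorem measurable_toLine : Measurable toLine := by
  have : Measurable fun p : PredLabel => labelValue p.2 := measurable_labelValue.comp measurable_snd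
  unfold toLine
  fun_prop

theorem measurable_ofLine : Measurable ofLine := by
  have h : Measurable (projIcc (0 : ℝ) 1 zero_le_one) := continuous_projIcc.measurable
  exact Measurable.ite measurableSet_Iic (h.prodMk measurable_const)
    ((h.comp (measurable_id.sub_const 2)).prodMk measurable_const)

theorem ofLine_toLine (p : PredLabel) : ofLine (toLine p) = p := by
  obtain ⟨v, y⟩ := p
  cases y
  · simp [ofLine, toLine, labelValue, v.2.2]
  · have : ¬ (v : ℝ) + 2 ≤ 1 := by linarith [v.2.1]
    simp [ofLine, toLine, labelValue, this]

theorem toLine_mem_Icc (p : PredLabel) : toLine p ∈ Icc (0 : ℝ) 3 := by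
  have h := p.1.2
  have h' := labelValue_mem_Icc p.2
  exact ⟨by unfold toLine; linarith [h.1, h'.1], by unfold toLine; linarith [h.2, h'.2]⟩

theorem transportCost_le (p q : PredLabel) : transportCost p q ≤ 2 * |toLine p - toLine q| := by
  obtain ⟨v, y⟩ := p
  obtain ⟨w, z⟩ := q
  have hv := v.2
  have hw := w.2
  have h1 : |(v : ℝ) - w| ≤ 1 := abs_le.2 ⟨by linarith [hv.1, hw.2], by linarith [hv.2, hw.1]⟩
  cases y <;> cases z <;> simp only [transportCost, toLine, labelValue, if_true, Bool.false_eq_true,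
    if_false] <;> norm_num
  · linarith [abs_nonneg ((v : ℝ) - w)]
  · linarith [hv.2, hw.1, neg_le_abs ((v : ℝ) - (w + 2))]
  · linarith [hv.1, hw.2, le_abs_self ((v : ℝ) + 2 - w)]
  · linarith [abs_nonneg ((v : ℝ) - w)]

theorem map_ofLine_map_toLine (Γ : Measure PredLabel) : (Γ.map toLine).map ofLine = Γ := by
  rw [Measure.map_map measurable_ofLine measurable_toLine]
  have : ofLine ∘ toLine = id := funext ofLine_toLine
  rw [this, Measure.map_id]

theorem cdf_map_toLine (Γ : Measure PredLabel) [IsProbabilityMeasure Γ] (t : ℝ) :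
    cdf (Γ.map toLine) t = Γ.real {p | toLine p ≤ t} := by
  have : IsProbabilityMeasure (Γ.map toLine) :=
    Measure.isProbabilityMeasure_map measurable_toLine.aemeasurable
  rw [cdf_eq_real, map_measureReal_apply measurable_toLine measurableSet_Iic]
  rfl

/-- The lower distance to calibration is Lipschitz for the `L¹` distance of the distribution
functions on the line. -/
theorem ofReal_abs_lowerDCE_sub_le (Γ Γ' : Measure PredLabel) [IsProbabilityMeasure Γ]
    [IsProbabilityMeasure Γ'] :
    ENNReal.ofReal |lowerDCE Γ - lowerDCE Γ'| ≤
      2 * ∫⁻ t in Icc 0 3,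
        ENNReal.ofReal |Γ.real {p | toLine p ≤ t} - Γ'.real {p | toLine p ≤ t}| := by
  have hprob : ∀ Δ : Measure PredLabel, IsProbabilityMeasure Δ →
      IsProbabilityMeasure (Δ.map toLine) := fun Δ _ =>
    Measure.isProbabilityMeasure_map measurable_toLine.aemeasurable
  have hΓ := hprob Γ inferInstance
  have hΓ' := hprob Γ' inferInstance
  set Q := lowerQuantile (Γ.map toLine) with hQdef
  set Q' := lowerQuantile (Γ'.map toLine) with hQ'def
  have hQ : AEMeasurable Q uniformMeasure := aemeasurable_lowerQuantile _
  have hQ' : AEMeasurable Q' uniformMeasure := aemeasurable_lowerQuantile _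
  have hdQ : AEMeasurable (fun ω => ofLine (Q ω)) uniformMeasure :=
    measurable_ofLine.comp_aemeasurable hQ
  have hdQ' : AEMeasurable (fun ω => ofLine (Q' ω)) uniformMeasure :=
    measurable_ofLine.comp_aemeasurable hQ'
  have hlaw : ∀ Δ : Measure PredLabel, IsProbabilityMeasure Δ →
      uniformMeasure.map (fun ω => ofLine (lowerQuantile (Δ.map toLine) ω)) = Δ := fun Δ hΔ => by
    have := hprob Δ hΔ
    conv_rhs => rw [← map_ofLine_map_toLine Δ, ← map_lowerQuantile (Δ.map toLine)]
    rw [AEMeasurable.map_map_of_aemeasurable measurable_ofLine.aemeasurable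
      (aemeasurable_lowerQuantile _)]
    rfl
  have hrange : ∀ Δ : Measure PredLabel, IsProbabilityMeasure Δ →
      ∀ᵐ ω ∂uniformMeasure, toLine (ofLine (lowerQuantile (Δ.map toLine) ω)) =
        lowerQuantile (Δ.map toLine) ω := fun Δ hΔ => by
    have := hprob Δ hΔ
    refine ae_of_ae_map (aemeasurable_lowerQuantile (Δ.map toLine)) 
      (p := fun x => toLine (ofLine x) = x) ?_
    rw [map_lowerQuantile]
    refine (ae_map_iff measurable_toLine.aemeasurable
      (measurableSet_eq_fun (measurable_toLine.comp measurable_ofLine) measurable_id)).2 ?_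
    exact ae_of_all _ fun p => congrArg toLine (ofLine_toLine p)
  let κ := uniformMeasure.map fun ω => (ofLine (Q ω), ofLine (Q' ω))
  have hκ : IsProbabilityMeasure κ := Measure.isProbabilityMeasure_map (hdQ.prodMk hdQ')
  have hfst : κ.fst = Γ := (Measure.fst_map_prodMk₀ hdQ').trans (hlaw Γ inferInstance)
  have hsnd : κ.snd = Γ' := (Measure.snd_map_prodMk₀ hdQ).trans (hlaw Γ' inferInstance)
  have hLip := abs_lowerDCE_sub_le κ
  rw [hfst, hsnd] at hLip
  have hint : Integrable (fun r : PredLabel × PredLabel => transportCost r.1 r.2) κ :=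
    integrable_of_mem_Icc measurable_transportCost fun r => transportCost_mem_Icc _ _
  calc ENNReal.ofReal |lowerDCE Γ - lowerDCE Γ'|
      ≤ ENNReal.ofReal (∫ r, transportCost r.1 r.2 ∂κ) := ENNReal.ofReal_le_ofReal hLip
    _ = ∫⁻ r, ENNReal.ofReal (transportCost r.1 r.2) ∂κ :=
        ofReal_integral_eq_lintegral_ofReal hint
          (ae_of_all _ fun r => (transportCost_mem_Icc _ _).1)
    _ = ∫⁻ ω, ENNReal.ofReal (transportCost (ofLine (Q ω)) (ofLine (Q' ω))) ∂uniformMeasure :=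
        lintegral_map' measurable_transportCost.ennreal_ofReal.aemeasurable (hdQ.prodMk hdQ')
    _ ≤ ∫⁻ ω, 2 * ENNReal.ofReal |Q ω - Q' ω| ∂uniformMeasure := by
        refine lintegral_mono_ae ?_
        filter_upwards [hrange Γ inferInstance, hrange Γ' inferInstance] with ω h1 h2
        rw [← ENNReal.ofReal_ofNat, ← ENNReal.ofReal_mul zero_le_two]
        refine ENNReal.ofReal_le_ofReal ((transportCost_le _ _).trans_eq ?_)
        rw [h1, h2]
    _ = 2 * ∫⁻ ω, ENNReal.ofReal |Q ω - Q' ω| ∂uniformMeasure :=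
        lintegral_const_mul' _ _ (by simp)
    _ ≤ 2 * ∫⁻ t, ENNReal.ofReal |cdf (Γ.map toLine) t - cdf (Γ'.map toLine) t| := by
        exact mul_le_mul_right (lintegral_abs_lowerQuantile_sub_le _ _) _
    _ = _ := by
        simp only [cdf_map_toLine]
        congr 1
        refine (setLIntegral_eq_of_support_subset ?_).symm
        -- Both distribution functions are `0` to the left of `0` and `1` to the right of `3`.
        intro t ht
        by_contra hout
        apply ht
        rcases lt_or_ge t 0 with h0 | h0
        · have : {p : PredLabel | toLine p ≤ t} = ∅ :=
            eq_empty_of_forall_notMem fun p hp => by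
              linarith [(toLine_mem_Icc p).1, show toLine p ≤ t from hp]
          simp [this]
        · have h3 : 3 < t := lt_of_not_ge fun h => hout ⟨h0, h⟩
          have : {p : PredLabel | toLine p ≤ t} = univ :=
            eq_univ_of_forall fun p => (toLine_mem_Icc p).2.trans h3.le
          simp [this]

/-! ### The empirical distribution -/

theorem isProbabilityMeasure_empiricalMeasure {n : ℕ} (hn : n ≠ 0) (S : Fin n → PredLabel) :
    IsProbabilityMeasure (empiricalMeasure S) := by
  refine ⟨?_⟩
  simp [empiricalMeasure, ENNReal.inv_mul_cancel (Nat.cast_ne_zero.2 hn) (ENNReal.natCast_ne_top n)]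

theorem empiricalMeasure_real_apply {n : ℕ} (S : Fin n → PredLabel) {A : Set PredLabel}
    (hA : MeasurableSet A) :
    (empiricalMeasure S).real A = (n : ℝ)⁻¹ * ∑ i, A.indicator 1 (S i) := by
  have h : ∀ i, Measure.dirac (S i) A = ENNReal.ofReal (A.indicator 1 (S i)) := fun i => by
    rw [Measure.dirac_apply' _ hA]
    by_cases hi : S i ∈ A <;> simp [hi]
  have h0 : ∀ i, 0 ≤ A.indicator (1 : PredLabel → ℝ) (S i) := fun i =>
    indicator_nonneg (fun _ _ => zero_le_one) _
  simp only [measureReal_def, empiricalMeasure, Measure.smul_apply, Measure.finsetSum_apply, h,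
    smul_eq_mul, ENNReal.toReal_mul, ENNReal.toReal_inv, ENNReal.toReal_natCast]
  rw [ENNReal.toReal_sum (by simp)]
  simp only [ENNReal.toReal_ofReal (h0 _)]

section

variable (Γ : Measure PredLabel) [IsProbabilityMeasure Γ]

theorem measurable_empiricalMeasure_real {n : ℕ} {A : Set PredLabel} (hA : MeasurableSet A) :
    Measurable fun S : Fin n → PredLabel => (empiricalMeasure S).real A := by
  simp only [empiricalMeasure_real_apply _ hA]
  have : Measurable (A.indicator (1 : PredLabel → ℝ)) := measurable_one.indicator hA
  fun_prop

theorem integral_sq_empiricalMeasure_sub_le {n : ℕ} (hn : n ≠ 0) {A : Set PredLabel}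
    (hA : MeasurableSet A) :
    ∫ S, ((empiricalMeasure S).real A - Γ.real A) ^ 2 ∂Measure.pi (fun _ : Fin n => Γ)
      ≤ (n : ℝ)⁻¹ := by
  have hn' : (0 : ℝ) < n := by positivity
  have hm : Measurable (A.indicator (1 : PredLabel → ℝ)) := measurable_one.indicator hA
  have hI : ∀ p, A.indicator (1 : PredLabel → ℝ) p ∈ Icc (0 : ℝ) 1 := fun p => by
    by_cases hp : p ∈ A <;> simp [hp]
  have hL2 : MemLp (A.indicator (1 : PredLabel → ℝ)) 2 Γ :=
    memLp_of_bounded (ae_of_all _ hI) hm.aestronglyMeasurable 2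
  have hint : Integrable (A.indicator (1 : PredLabel → ℝ)) Γ := hL2.integrable one_le_two
  set X : (Fin n → PredLabel) → ℝ := ∑ i, fun S => A.indicator (1 : PredLabel → ℝ) (S i) with hX
  have hXm : Measurable X := by
    rw [hX]
    fun_prop
  have hmean : (Measure.pi fun _ : Fin n => Γ)[X] = n * Γ.real A := by
    simp only [hX, Finset.sum_apply]
    rw [integral_finsetSum _ fun i _ => integrable_comp_eval hint]
    have hi : ∀ i, ∫ S, A.indicator (1 : PredLabel → ℝ) (S i) ∂(Measure.pi fun _ : Fin n => Γ)
        = Γ.real A := fun i => by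
      rw [← integral_indicator_one hA]
      exact integral_comp_eval (μ := fun _ : Fin n => Γ) hm.aestronglyMeasurable
    simp [hi]
  have hvar : Var[X; Measure.pi fun _ : Fin n => Γ] ≤ n := by
    rw [hX, variance_sum_pi (fun _ => hL2)]
    calc ∑ _i : Fin n, Var[A.indicator (1 : PredLabel → ℝ); Γ] ≤ ∑ _i : Fin n, (1 : ℝ) := by
          refine Finset.sum_le_sum fun i _ => ?_
          exact (variance_le_sq_of_bounded (ae_of_all _ hI) hm.aemeasurable).trans (by norm_num)
      _ = n := by simp
  calc ∫ S, ((empiricalMeasure S).real A - Γ.real A) ^ 2 ∂Measure.pi (fun _ : Fin n => Γ)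
      = ((n : ℝ)⁻¹) ^ 2 * Var[X; Measure.pi fun _ : Fin n => Γ] := by
        rw [variance_eq_integral hXm.aemeasurable, hmean, ← integral_const_mul]
        refine integral_congr_ae (ae_of_all _ fun S => ?_)
        simp only [empiricalMeasure_real_apply S hA, hX, Finset.sum_apply]
        field_simp
    _ ≤ ((n : ℝ)⁻¹) ^ 2 * n := by gcongr
    _ = (n : ℝ)⁻¹ := by field_simp

theorem lintegral_abs_empiricalMeasure_sub_le {n : ℕ} (hn : n ≠ 0) {A : Set PredLabel}
    (hA : MeasurableSet A) :
    ∫⁻ S, ENNReal.ofReal |(empiricalMeasure S).real A - Γ.real A| ∂Measure.pi (fun _ : Fin n => Γ)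
      ≤ ENNReal.ofReal (Real.sqrt n)⁻¹ := by
  have hs : 0 < Real.sqrt n := Real.sqrt_pos.2 (by positivity)
  have hmeas := measurable_empiricalMeasure_real (n := n) hA
  have hbound : ∀ S : Fin n → PredLabel,
      (empiricalMeasure S).real A - Γ.real A ∈ Icc (-1 : ℝ) 1 := fun S => by
    have := isProbabilityMeasure_empiricalMeasure hn S
    have h1 : (empiricalMeasure S).real A ≤ 1 := measureReal_le_one
    have h2 : Γ.real A ≤ 1 := measureReal_le_one
    have h3 : 0 ≤ (empiricalMeasure S).real A := measureReal_nonneg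
    have h4 : 0 ≤ Γ.real A := measureReal_nonneg
    exact ⟨by linarith, by linarith⟩
  have hint : Integrable (fun S => (empiricalMeasure S).real A - Γ.real A)
      (Measure.pi fun _ : Fin n => Γ) := integrable_of_mem_Icc (hmeas.sub_const _) hbound
  have hint2 : Integrable (fun S => ((empiricalMeasure S).real A - Γ.real A) ^ 2)
      (Measure.pi fun _ : Fin n => Γ) :=
    integrable_of_mem_Icc (a := 0) (b := 1) ((hmeas.sub_const _).pow_const 2) fun S =>
      ⟨sq_nonneg _, by nlinarith [(hbound S).1, (hbound S).2]⟩
  rw [← ofReal_integral_eq_lintegral_ofReal hint.abs (ae_of_all _ fun _ => abs_nonneg _)]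
  refine ENNReal.ofReal_le_ofReal ?_
  calc ∫ S, |(empiricalMeasure S).real A - Γ.real A| ∂Measure.pi (fun _ : Fin n => Γ)
      ≤ ∫ S, (Real.sqrt n / 2 * ((empiricalMeasure S).real A - Γ.real A) ^ 2
          + (Real.sqrt n)⁻¹ / 2) ∂Measure.pi (fun _ : Fin n => Γ) := by
        refine integral_mono hint.abs ((hint2.const_mul _).add (integrable_const _)) fun S => ?_
        -- The inequality between arithmetic and geometric means, with weight `√n`.
        generalize (empiricalMeasure S).real A - Γ.real A = x
        have h : 0 ≤ (Real.sqrt n * |x| - 1) ^ 2 / (2 * Real.sqrt n) := by positivity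
        have h' : (Real.sqrt n * |x| - 1) ^ 2 / (2 * Real.sqrt n)
            = Real.sqrt n / 2 * |x| ^ 2 + (Real.sqrt n)⁻¹ / 2 - |x| := by
          field_simp
          ring
        rw [sq_abs] at h'
        dsimp only
        linarith
    _ = Real.sqrt n / 2 * ∫ S, ((empiricalMeasure S).real A - Γ.real A) ^ 2
          ∂Measure.pi (fun _ : Fin n => Γ) + (Real.sqrt n)⁻¹ / 2 := by
        rw [integral_add (hint2.const_mul _) (integrable_const _), integral_const_mul]
        simp
    _ ≤ Real.sqrt n / 2 * (n : ℝ)⁻¹ + (Real.sqrt n)⁻¹ / 2 := by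
        gcongr
        exact integral_sq_empiricalMeasure_sub_le Γ hn hA
    _ = (Real.sqrt n)⁻¹ := by
        have : (n : ℝ)⁻¹ = (Real.sqrt n)⁻¹ * (Real.sqrt n)⁻¹ := by
          rw [← mul_inv, Real.mul_self_sqrt n.cast_nonneg]
        rw [this]
        field_simp
        norm_num

theorem measurable_empiricalMeasure_sublevel {n : ℕ} :
    Measurable fun q : (Fin n → PredLabel) × ℝ =>
      ENNReal.ofReal |(empiricalMeasure q.1).real {p | toLine p ≤ q.2}
        - Γ.real {p | toLine p ≤ q.2}| := by
  have hA : ∀ t, MeasurableSet {p : PredLabel | toLine p ≤ t} := fun t =>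
    measurable_toLine measurableSet_Iic
  have hΓ : Measurable fun t => Γ.real {p | toLine p ≤ t} := by
    simp only [← cdf_map_toLine]
    exact (monotone_cdf _).measurable
  have hi : ∀ i, Measurable fun q : (Fin n → PredLabel) × ℝ =>
      {p : PredLabel | toLine p ≤ q.2}.indicator (1 : PredLabel → ℝ) (q.1 i) := fun i => by
    have : MeasurableSet {q : (Fin n → PredLabel) × ℝ | toLine (q.1 i) ≤ q.2} :=
      measurableSet_le (measurable_toLine.comp ((measurable_pi_apply i).comp measurable_fst))
        measurable_snd
    have h : Measurable ({q : (Fin n → PredLabel) × ℝ | toLine (q.1 i) ≤ q.2}.indicator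
      (1 : (Fin n → PredLabel) × ℝ → ℝ)) := measurable_one.indicator this
    exact h
  simp only [empiricalMeasure_real_apply _ (hA _)]
  have hΓ' : Measurable fun q : (Fin n → PredLabel) × ℝ => Γ.real {p | toLine p ≤ q.2} :=
    hΓ.comp measurable_snd
  exact (((Finset.measurable_fun_sum _ fun i _ => hi i).const_mul _).sub hΓ').abs.ennreal_ofReal

/-- The expected `L¹` distance between the empirical and the true distribution function is of order
`1 / √n`: exchange the integrals and bound the deviation at each point of `[0, 3]`. -/
theorem lintegral_lintegral_abs_empiricalMeasure_sub_le {n : ℕ} (hn : n ≠ 0) :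
    ∫⁻ S, (∫⁻ t in Icc 0 3, ENNReal.ofReal |(empiricalMeasure S).real {p | toLine p ≤ t}
        - Γ.real {p | toLine p ≤ t}|) ∂Measure.pi (fun _ : Fin n => Γ)
      ≤ ENNReal.ofReal (3 * (Real.sqrt n)⁻¹) := by
  rw [lintegral_lintegral_swap (measurable_empiricalMeasure_sublevel Γ).aemeasurable]
  calc _ ≤ ∫⁻ _ in Icc (0 : ℝ) 3, ENNReal.ofReal (Real.sqrt n)⁻¹ :=
        lintegral_mono fun t =>
          lintegral_abs_empiricalMeasure_sub_le Γ hn (measurable_toLine measurableSet_Iic)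
    _ = ENNReal.ofReal (3 * (Real.sqrt n)⁻¹) := by
        rw [setLIntegral_const, Real.volume_Icc, ← ENNReal.ofReal_mul (by positivity), mul_comm,
          sub_zero]

end

/- The probability is bounded through the failure event, so that the bound is meaningful (as a bound
on an outer measure) without presupposing that the event is measurable. -/
theorem mainTheorem9 :
    ∃ C : ℝ, 0 < C ∧
      ∀ (Γ : Measure PredLabel) [IsProbabilityMeasure Γ] (ε : ℝ), 0 < ε →
        ∀ n : ℕ, C / ε ^ 2 ≤ (n : ℝ) →
          Measure.pi (fun _ : Fin n => Γ)
            {S : Fin n → PredLabel | ¬ |lowerDCE (empiricalMeasure S) - lowerDCE Γ| ≤ ε} ≤ 1 / 3 := by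
  -- Markov's inequality bounds the failure probability by `2 * 3 / (√n * ε)`; `324 = (3 * 2 * 3)²`.
  refine ⟨324, by norm_num, fun Γ _ ε hε n hnC => ?_⟩
  have hnpos : (0 : ℝ) < n := lt_of_lt_of_le (by positivity) hnC
  have hn : n ≠ 0 := by
    rintro rfl
    simp at hnpos
  have hsqrt : 18 ≤ Real.sqrt n * ε := by
    have h1 : (18 / ε) ^ 2 ≤ n := by
      rw [div_pow]
      norm_num
      exact hnC
    exact (div_le_iff₀ hε).1 (Real.le_sqrt_of_sq_le h1)
  have hs : 0 < Real.sqrt n := Real.sqrt_pos.2 hnpos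
  let D : (Fin n → PredLabel) → ENNReal := fun S =>
    ∫⁻ t in Icc 0 3, ENNReal.ofReal |(empiricalMeasure S).real {p | toLine p ≤ t}
      - Γ.real {p | toLine p ≤ t}|
  have hD : Measurable D := (measurable_empiricalMeasure_sublevel Γ).lintegral_prod_right'
  calc Measure.pi (fun _ : Fin n => Γ)
        {S : Fin n → PredLabel | ¬ |lowerDCE (empiricalMeasure S) - lowerDCE Γ| ≤ ε}
      ≤ Measure.pi (fun _ : Fin n => Γ) {S | ENNReal.ofReal (ε / 2) ≤ D S} := by
        refine measure_mono fun S hS => ?_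
        have := isProbabilityMeasure_empiricalMeasure hn S
        have hle := ofReal_abs_lowerDCE_sub_le (empiricalMeasure S) Γ
        have hS' : ENNReal.ofReal ε ≤ 2 * D S :=
          (ENNReal.ofReal_le_ofReal (not_le.1 hS).le).trans hle
        change ENNReal.ofReal (ε / 2) ≤ D S
        rw [ENNReal.ofReal_div_of_pos two_pos, ENNReal.ofReal_ofNat]
        exact ENNReal.div_le_of_le_mul' hS'
    _ ≤ (∫⁻ S, D S ∂Measure.pi (fun _ : Fin n => Γ)) / ENNReal.ofReal (ε / 2) :=
        meas_ge_le_lintegral_div hD.aemeasurable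
          (ENNReal.ofReal_pos.2 (by positivity)).ne' ENNReal.ofReal_ne_top
    _ ≤ ENNReal.ofReal (3 * (Real.sqrt n)⁻¹) / ENNReal.ofReal (ε / 2) := by
        gcongr
        exact lintegral_lintegral_abs_empiricalMeasure_sub_le Γ hn
    _ = ENNReal.ofReal (3 * (Real.sqrt n)⁻¹ / (ε / 2)) :=
        (ENNReal.ofReal_div_of_pos (by positivity)).symm
    _ ≤ ENNReal.ofReal (1 / 3) := by
        refine ENNReal.ofReal_le_ofReal ?_
        rw [div_le_iff₀ (by positivity), ← div_eq_mul_inv, div_le_iff₀ hs]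
        linarith
    _ = 1 / 3 := by
        rw [ENNReal.ofReal_div_of_pos (by norm_num)]
        simp
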